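/- Let $F$ be an algebraically closed field and let $1\le m\le n$ be integers. Let $R=F[x_{i,j},y_{i,j} : 1\le i\le m,\ 1\le j\le n]$, let $X(t)=(x_{i,j}+y_{i,j}t)_{i,j}$ be the generic $m\times n$ matrix over $R[t]/(t^2)$, and let $I\subseteq R$ be the ideal generated by the coefficients of $1$ and $t$ in all $2\times 2$ minors of $X(t)$. The zero set of $I$ in affine space $F^{mn}\times F^{mn}$ is the variety of first-order jets over the variety $V$ of $m\times n$ matrices over $F$ of rank at most $1$. Let $Y$ be its principal component, i.e. the Zariski closure of the set of points $(x,y)$ in the zero set of $I$ for which $x$ is a nonsingular point of $V$, and let $J\subseteq R$ be the ideal of all polynomials vanishing on $Y$. Then the Krull dimension of $R/J$ is $2(m+n)-2$. -/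

import Mathlib

noncomputable section

namespace DetJet

open MvPolynomial

/-! ### Affine varieties and their nonsingular points -/

section Varieties

variable {F : Type*} [Field F] {σ : Type*}

/-- The coordinate ring `F[σ] / I(V)` of a set `V` of points of affine space. -/
abbrev CoordinateRing (V : Set (σ → F)) : Type _ :=
  MvPolynomial σ F ⧸ vanishingIdeal F V

/-- Evaluation of regular functions on `V` at a point `p` of `V`. -/
def evalAt (V : Set (σ → F)) (p : V) : CoordinateRing V →ₐ[F] F :=
  Ideal.Quotient.liftₐ (vanishingIdeal F V) (aeval (p : σ → F)) fun _ hf => hf p p.2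

instance (V : Set (σ → F)) (p : V) : (RingHom.ker (evalAt V p)).IsPrime :=
  RingHom.ker_isPrime (evalAt V p).toRingHom

/-- The local ring of `V` at `p`: the localization of the coordinate ring of `V` at the maximal
ideal of all regular functions that vanish at `p`. -/
abbrev LocalRingAt (V : Set (σ → F)) (p : V) : Type _ :=
  Localization.AtPrime (RingHom.ker (evalAt V p))

/-- `p` is a nonsingular point of `V`: the local ring of `V` at `p` is a regular local ring. -/
def IsNonsingularPoint (V : Set (σ → F)) (p : V) : Prop :=
  IsRegularLocalRing (LocalRingAt V p)

/-- The Zariski closure of a set of points of affine space. -/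
def zariskiClosure (S : Set (σ → F)) : Set (σ → F) :=
  zeroLocus F (vanishingIdeal F S)

end Varieties

/-! ### First-order jets over the variety of matrices of rank at most one -/

/-- The variables: `Sum.inl (i, j)` is `x_{i,j}` and `Sum.inr (i, j)` is `y_{i,j}`. -/
abbrev JetVar (m n : ℕ) : Type :=
  (Fin m × Fin n) ⊕ (Fin m × Fin n)

variable (F : Type*) [Field F] (m n : ℕ)

/-- The polynomial ring `R = F[x_{i,j}, y_{i,j}]`. -/
abbrev JetRing : Type _ :=
  MvPolynomial (JetVar m n) F

/-- The generic matrix `X(t) = (x_{i,j} + y_{i,j} t)` over `R[t]/(t^2)`; the ring `R[t]/(t^2)` is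
the ring of dual numbers over `R`, with `t` the class `DualNumber.eps`. -/
def genericMatrix : Matrix (Fin m) (Fin n) (DualNumber (JetRing F m n)) :=
  Matrix.of fun i j =>
    algebraMap (JetRing F m n) (DualNumber (JetRing F m n)) (X (Sum.inl (i, j))) +
      algebraMap (JetRing F m n) (DualNumber (JetRing F m n)) (X (Sum.inr (i, j))) *
        DualNumber.eps

/-- The `2 × 2` minor of the generic matrix on rows `i, j` and columns `k, l`. -/
def minor (i j : Fin m) (k l : Fin n) : DualNumber (JetRing F m n) :=
  ((genericMatrix F m n).submatrix ![i, j] ![k, l]).det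

/-- The ideal `I` of `R` generated by the coefficients of `1` and `t` in all `2 × 2` minors of the
generic matrix `X(t)`. -/
def jetIdeal : Ideal (JetRing F m n) :=
  Ideal.span {f | ∃ (i j : Fin m) (k l : Fin n), i < j ∧ k < l ∧
    (f = TrivSqZeroExt.fst (minor F m n i j k l) ∨ f = TrivSqZeroExt.snd (minor F m n i j k l))}

/-- The variety of first-order jets over the variety of matrices of rank at most one: the zero set
of `I`. -/
def jetVariety : Set (JetVar m n → F) :=
  zeroLocus F (jetIdeal F m n)

/-- The classical determinantal variety of `m × n` matrices of rank at most one. -/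
def detVariety : Set (Fin m × Fin n → F) :=
  {a | (Matrix.of fun i j => a (i, j)).rank ≤ 1}

/-- The jets (tangent vectors) whose base point is a nonsingular point of the determinantal
variety. -/
def nonsingularJets : Set (JetVar m n → F) :=
  {z | z ∈ jetVariety F m n ∧
    ∃ h : (fun p => z (Sum.inl p)) ∈ detVariety F m n,
      IsNonsingularPoint (detVariety F m n) ⟨fun p => z (Sum.inl p), h⟩}

/-- The principal component `Y` of the jet variety: the closure of the set of tangents at the
nonsingular points of the determinantal variety. -/
def principalComponent : Set (JetVar m n → F) :=
  zariskiClosure (nonsingularJets F m n)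

/-- The ideal `J` of the principal component `Y`: all polynomials that vanish on `Y`. -/
def principalIdeal : Ideal (JetRing F m n) :=
  vanishingIdeal F (principalComponent F m n)

end DetJet

end

/-!
The proof rests on the parametrization of first-order jets of matrices of rank at most one by the
jets of the curves `(a + t c) (b + t d)ᵀ`, that is, `x i j = a i * b j` and
`y i j = a i * d j + c i * b j`. Normalized by `a i₀ = 1` and `c i₀ = 0`, it has
`2 (m + n - 1)` parameters, and it is an isomorphism onto the jets whose base point has a nonzero
entry at `(i₀, j₀)` once `b j₀` is inverted.

*The ideal of the principal component is the kernel of the pullback `jetChart`*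
(`principalIdeal_eq_ker`). A nonzero matrix in the determinantal variety `V` is a nonsingular point:
the maximal ideal of its local ring has `m + n - 1` generators, and the local ring surjects onto a
local ring of a polynomial ring in as many variables (`isNonsingularPoint_detVariety`). The zero
matrix is singular as soon as `m, n ≥ 2`: `V` contains the coordinate axes, so its embedding
dimension there is `m n`, whereas `dim V < m n` (`not_isNonsingularPoint_detVariety`). If `m = 1`
the zero matrix is nonsingular, but the jets at it are covered by the parametrization as well. Hence
a polynomial that vanishes on the parametrized jets vanishes on all jets at nonsingular points, and
conversely because `b j₀ ≠ 0` defines a dense set of parameters.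

*The quotient by the kernel has dimension `2 (m + n) - 2`*
(`ringKrullDim_quotient_ker_jetChart`). It embeds in a polynomial ring in that number of variables,
and by Noether normalization its dimension does not exceed the number of variables
(`ringKrullDim_le_natCard_of_injective`). Conversely, one of its local rings surjects onto a local
ring of that polynomial ring at a point (`height_le_height_comap`), and all points of affine space
have height equal to its dimension (`height_vanishingIdeal_singleton`).
-/

noncomputable section

namespace DetJet

open MvPolynomial IsLocalRing

/-! ### Krull dimension of finitely generated algebras and of points of affine space -/

theorem ringKrullDim_le_of_isIntegral {A B : Type*} [CommRing A] [CommRing B] (f : A →+* B)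
    (hf : f.IsIntegral) : ringKrullDim B ≤ ringKrullDim A := by
  algebraize [f]
  refine Order.krullDim_le_of_strictMono (PrimeSpectrum.comap f) fun p q hpq => ?_
  exact Ideal.IsIntegral.comap_lt_comap (R := A) (I := p.asIdeal) (J := q.asIdeal) hpq

/-- A finitely generated algebra inside a polynomial ring has at most the dimension of that ring:
a Noether normalization of it consists of algebraically independent elements of the polynomial
ring. -/
theorem ringKrullDim_le_natCard_of_injective {F A τ : Type*} [Field F] [CommRing A] [Algebra F A]
    [Algebra.FiniteType F A] [Finite τ] (f : A →ₐ[F] MvPolynomial τ F)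
    (hf : Function.Injective f) : ringKrullDim A ≤ Nat.card τ := by
  have : Nontrivial A := f.toRingHom.domain_nontrivial
  obtain ⟨s, g, hg, hgi⟩ := exists_integral_inj_algHom_of_fg F A
  have hs : s ≤ Nat.card τ := by
    have h := lift_trdeg_le_of_injective (f.comp g) (hf.comp hg)
    rw [MvPolynomial.trdeg_of_isDomain, MvPolynomial.trdeg_of_isDomain] at h
    have := Fintype.ofFinite τ
    simp only [Cardinal.mk_fintype, Cardinal.lift_natCast, Fintype.card_fin, Nat.cast_le] at h
    simpa using h
  refine (ringKrullDim_le_of_isIntegral g.toRingHom hgi).trans ?_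
  rw [MvPolynomial.ringKrullDim_of_isNoetherianRing, ringKrullDim_eq_zero_of_field, zero_add,
    Nat.card_fin]
  exact_mod_cast hs

/-- All points of affine space have the same height, because translations act transitively; so each
of them attains the dimension. -/
theorem height_vanishingIdeal_singleton {F τ : Type*} [Field F] [IsAlgClosed F] [Finite τ]
    (x : τ → F) : (vanishingIdeal F {x}).height = Nat.card τ := by
  have key : ∀ y z : τ → F, (vanishingIdeal F {y}).height ≤ (vanishingIdeal F {z}).height := by
    intro y z
    let t (v : τ → F) : MvPolynomial τ F →ₐ[F] MvPolynomial τ F := aeval fun i => X i + C (v i)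
    have ht (v : τ → F) : (t (-v)).comp (t v) = AlgHom.id F _ := by
      ext i; simp [t]
    let e : MvPolynomial τ F ≃ₐ[F] MvPolynomial τ F :=
      AlgEquiv.ofAlgHom (t (z - y)) (t (y - z))
        (by simpa using ht (y - z)) (by simpa using ht (z - y))
    have he : vanishingIdeal F {z} = (vanishingIdeal F {y}).comap (e : _ →+* _) := by
      ext f
      have : (aeval y).comp (t (z - y)) = aeval z := by
        ext i; simp [t]
      have h := DFunLike.congr_fun this f
      simp only [AlgHom.comp_apply] at h
      simp only [mem_vanishingIdeal_singleton_iff, Ideal.mem_comap, ← h]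
      rfl
    rw [he]
    exact (RingEquiv.height_comap e.toRingEquiv (vanishingIdeal F {y})).ge
  have h := Ideal.sup_isMaximal_height_eq_ringKrullDim (R := MvPolynomial τ F)
  rw [MvPolynomial.ringKrullDim_of_isNoetherianRing, ringKrullDim_eq_zero_of_field, zero_add] at h
  have h' : (⨆ (I : Ideal (MvPolynomial τ F)) (_ : I.IsMaximal), I.height) = (Nat.card τ : ℕ∞) := by
    exact_mod_cast h
  rw [← h']
  refine le_antisymm (le_iSup₂_of_le (vanishingIdeal F {x}) inferInstance le_rfl)
    (iSup₂_le fun I hI => ?_)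
  obtain ⟨y, rfl⟩ := isMaximal_iff_eq_vanishingIdeal_singleton.1 hI
  exact key y x

/-- If a ring homomorphism becomes surjective after inverting an element outside the prime `p`,
then it is surjective on the local rings at `p` and the prime above it. -/
theorem height_le_height_comap {A B : Type*} [CommRing A] [CommRing B] (f : A →+* B)
    (q : Ideal B) [q.IsPrime] (p : Ideal A) [p.IsPrime] (hp : p = q.comap f) (s : A) (hs : s ∉ p)
    (h : ∀ b : B, ∃ (n : ℕ) (a : A), f a = f s ^ n * b) : q.height ≤ p.height := by
  have : Function.Surjective (Localization.localRingHom p q f hp) := by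
    intro z
    obtain ⟨b, t, rfl⟩ := IsLocalization.exists_mk'_eq q.primeCompl z
    obtain ⟨k, a, ha⟩ := h b
    obtain ⟨l, u, hu⟩ := h t
    have hfs : f s ∉ q := by rwa [hp] at hs
    have hus : u * s ^ k ∈ p.primeCompl := by
      refine p.primeCompl.mul_mem ?_ (p.primeCompl.pow_mem hs k)
      change u ∉ p
      rw [hp, Ideal.mem_comap, hu]
      exact fun hm => (Ideal.IsPrime.mem_or_mem ‹_› hm).elim
        (fun h1 => hfs (Ideal.IsPrime.mem_of_pow_mem ‹_› _ h1)) t.2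
    refine ⟨IsLocalization.mk' _ (a * s ^ l) ⟨u * s ^ k, hus⟩, ?_⟩
    rw [Localization.localRingHom_mk', IsLocalization.mk'_eq_iff_eq]
    congr 1
    simp only [map_mul, map_pow, ha, hu]
    ring
  have h := ringKrullDim_le_of_surjective _ this
  rw [IsLocalization.AtPrime.ringKrullDim_eq_height q,
    IsLocalization.AtPrime.ringKrullDim_eq_height p] at h
  exact_mod_cast h

/-- For a homomorphism into a polynomial ring it suffices to reach the variables. -/
theorem exists_map_eq_pow_mul {F A τ : Type*} [Field F] [CommRing A] [Algebra F A]
    (f : A →ₐ[F] MvPolynomial τ F) (s : A)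
    (h : ∀ i, ∃ (n : ℕ) (a : A), f a = f s ^ n * X i) (b : MvPolynomial τ F) :
    ∃ (n : ℕ) (a : A), f a = f s ^ n * b := by
  induction b using MvPolynomial.induction_on with
  | C r => exact ⟨0, algebraMap F A r, by simp [MvPolynomial.algebraMap_eq]⟩
  | add p q hp hq =>
    obtain ⟨n, a, ha⟩ := hp
    obtain ⟨k, b, hb⟩ := hq
    exact ⟨n + k, s ^ k * a + s ^ n * b, by simp only [map_add, map_mul, map_pow, ha, hb]; ring⟩
  | mul_X p i hp =>
    obtain ⟨n, a, ha⟩ := hp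
    obtain ⟨k, b, hb⟩ := h i
    exact ⟨n + k, a * b, by simp only [map_mul, ha, hb]; ring⟩

/-! ### Singular and nonsingular points -/

theorem map_mem_of_aeval_eq_zero {F σ L : Type*} [Field F] [CommRing L]
    (ι : MvPolynomial σ F →+* L) (x : σ → F) {I : Ideal L} (h : ∀ i, ι (X i - C (x i)) ∈ I)
    {f : MvPolynomial σ F}
    (hf : aeval x f = 0) : ι f ∈ I := by
  -- Modulo `I` every polynomial is congruent to its value at `x`.
  let φ : MvPolynomial σ F →+* L ⧸ I := (Ideal.Quotient.mk I).comp ι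
  have : φ = (φ.comp C).comp (aeval x).toRingHom := by
    apply MvPolynomial.ringHom_ext
    · intro r; simp
    · intro i
      have := Ideal.Quotient.eq_zero_iff_mem.2 (h i)
      simp only [map_sub, sub_eq_zero] at this
      simpa [φ] using this
  have h2 : φ f = φ (C (aeval x f)) := DFunLike.congr_fun this f
  rw [← Ideal.Quotient.eq_zero_iff_mem]
  change φ f = 0
  rw [h2, hf, map_zero, map_zero]

theorem maximalIdeal_localization_le {A : Type*} [CommRing A] (p : Ideal A) [p.IsPrime]
    {I : Ideal (Localization.AtPrime p)} (h : ∀ a ∈ p, algebraMap A _ a ∈ I) :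
    maximalIdeal (Localization.AtPrime p) ≤ I := by
  rw [← Localization.AtPrime.map_eq_maximalIdeal, Ideal.map_le_iff_le_comap]
  exact h

theorem algebraMap_mem_maximalIdeal_iff {A : Type*} [CommRing A] (p : Ideal A) [p.IsPrime] (a : A) :
    algebraMap A (Localization.AtPrime p) a ∈ maximalIdeal (Localization.AtPrime p) ↔ a ∈ p := by
  rw [← Ideal.mem_comap, ← Ideal.under_def, IsLocalization.AtPrime.under_maximalIdeal _ p]

/-- A ring homomorphism from a local ring to the square-zero extension of `F` by `F ^ σ` bounds the
number of generators of the maximal ideal from below, once the tangent vectors it sees span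
`F ^ σ`. -/
theorem natCard_le_spanFinrank_maximalIdeal {F L σ : Type*} [Field F] [CommRing L] [IsLocalRing L]
    [IsNoetherianRing L] [Finite σ] [DecidableEq σ] (D : L →+* TrivSqZeroExt F (σ → F))
    (hD : ∀ g ∈ maximalIdeal L, (D g).fst = 0)
    (h : ∀ i, ∃ g ∈ maximalIdeal L, (D g).snd = Pi.single i 1) :
    Nat.card σ ≤ (maximalIdeal L).spanFinrank := by
  classical
  have := Fintype.ofFinite σ
  obtain ⟨s, hs, hspan⟩ := Submodule.FG.exists_span_finset_card_eq_spanFinrank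
    (maximalIdeal L).fg_of_isNoetherianRing
  have hsub : ∀ g ∈ maximalIdeal L,
      (D g).snd ∈ Submodule.span F ((fun g => (D g).snd) '' (s : Set L)) := by
    intro g hg
    rw [← hspan] at hg
    induction hg using Submodule.span_induction with
    | mem x hx => exact Submodule.subset_span ⟨x, hx, rfl⟩
    | zero => simp
    | add x y _ _ hx hy => simpa using add_mem hx hy
    | smul r x hx' hx =>
      have : (D x).fst = 0 := hD x (hspan ▸ hx')
      simpa [this] using Submodule.smul_mem _ (D r).fst hx
  have htop : Submodule.span F ((fun g => (D g).snd) '' (s : Set L)) = ⊤ := by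
    rw [eq_top_iff, ← (Pi.basisFun F σ).span_eq, Submodule.span_le]
    rintro _ ⟨i, rfl⟩
    obtain ⟨g, hg, hi⟩ := h i
    rw [Pi.basisFun_apply, ← hi]
    exact hsub g hg
  rw [← hs, Nat.card_eq_fintype_card, ← Module.finrank_fintype_fun_eq_card F]
  have h1 := finrank_span_finset_le_card (R := F) (s.image fun g => (D g).snd)
  rw [Set.finrank, Finset.coe_image, htop, finrank_top] at h1
  exact h1.trans Finset.card_image_le

/-- A ring homomorphism `A → TrivSqZeroExt F (σ → F)` whose scalar part has kernel `p` extends to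
the local ring at `p`. -/
theorem exists_localization_lift {F A M : Type*} [Field F] [CommRing A] [AddCommGroup M]
    [Module F M] [Module Fᵐᵒᵖ M] [IsCentralScalar F M] (p : Ideal A) [p.IsPrime]
    (δ : A →+* TrivSqZeroExt F M)
    (hδ : ∀ a, (δ a).fst = 0 ↔ a ∈ p) :
    ∃ D : Localization.AtPrime p →+* TrivSqZeroExt F M,
      (∀ a, D (algebraMap A _ a) = δ a) ∧
      ∀ g ∈ maximalIdeal (Localization.AtPrime p), (D g).fst = 0 := by
  let D : Localization.AtPrime p →+* TrivSqZeroExt F M :=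
    IsLocalization.lift (M := p.primeCompl) (g := δ) fun y => by
      rw [TrivSqZeroExt.isUnit_iff_isUnit_fst, isUnit_iff_ne_zero, ne_eq, hδ]
      exact y.2
  have hD (a : A) : D (algebraMap A _ a) = δ a := IsLocalization.lift_eq _ a
  have : maximalIdeal (Localization.AtPrime p) ≤
      RingHom.ker ((TrivSqZeroExt.fstHom F F M).toRingHom.comp D) := by
    refine maximalIdeal_localization_le p fun a ha => ?_
    rw [RingHom.mem_ker, RingHom.comp_apply, hD]
    exact (hδ a).2 ha
  exact ⟨D, hD, fun g hg => this hg⟩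

theorem not_isRegularLocalRing_of_height_lt {A : Type*} [CommRing A] (p : Ideal A) [p.IsPrime]
    (h : ((p.height : ℕ∞) : WithBot ℕ∞) < (maximalIdeal (Localization.AtPrime p)).spanFinrank) :
    ¬ IsRegularLocalRing (Localization.AtPrime p) := by
  intro hreg
  have h1 := hreg.spanFinrank_maximalIdeal
  rw [IsLocalization.AtPrime.ringKrullDim_eq_height p] at h1
  exact h.ne' h1

section Points

variable {F : Type*} [Field F] {σ : Type*}

/-- The Taylor expansion of a polynomial to first order at the origin: the scalar part is the value,
the square-zero part the gradient. -/
def taylorOne (F : Type*) [Field F] (σ : Type*) [DecidableEq σ] :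
    MvPolynomial σ F →ₐ[F] TrivSqZeroExt F (σ → F) :=
  aeval fun i => TrivSqZeroExt.inr (Pi.single i 1)

theorem fst_taylorOne [DecidableEq σ] (f : MvPolynomial σ F) :
    (taylorOne F σ f).fst = aeval (0 : σ → F) f := by
  have : (TrivSqZeroExt.fstHom F F (σ → F)).comp (taylorOne F σ) = aeval (0 : σ → F) := by
    ext i; simp [taylorOne]
  exact DFunLike.congr_fun this f

theorem taylorOne_eq_zero [Infinite F] [DecidableEq σ] {V : Set (σ → F)} (h0 : (0 : σ → F) ∈ V)
    (haxes : ∀ i (t : F), Pi.single i t ∈ V) {f : MvPolynomial σ F}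
    (hf : f ∈ vanishingIdeal F V) : taylorOne F σ f = 0 := by
  apply TrivSqZeroExt.ext
  · rw [fst_taylorOne]; exact hf 0 h0
  · ext i
    -- The `i`-th partial derivative at the origin only depends on the restriction to the axis.
    let r : MvPolynomial σ F →ₐ[F] Polynomial F := aeval (Pi.single i Polynomial.X)
    have hr : r f = 0 := by
      apply Polynomial.funext
      intro t
      have h1 : (Polynomial.aeval t).comp r = aeval (Pi.single i t) := by
        apply MvPolynomial.algHom_ext
        intro k
        by_cases hk : k = i
        · subst hk; simp [r]
        · simp [r, hk]
      have := DFunLike.congr_fun h1 f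
      rw [AlgHom.comp_apply, hf _ (haxes i t), Polynomial.coe_aeval_eq_eval] at this
      simpa using this
    have h2 : (TrivSqZeroExt.map (LinearMap.proj i : (σ → F) →ₗ[F] F)).comp (taylorOne F σ) =
        (Polynomial.aeval (TrivSqZeroExt.inr (1 : F))).comp r := by
      apply MvPolynomial.algHom_ext
      intro k
      by_cases hk : k = i
      · subst hk; simp [r, taylorOne]
      · simp [r, taylorOne, hk, Ne.symm hk]
    have := DFunLike.congr_fun h2 f
    rw [AlgHom.comp_apply, AlgHom.comp_apply, hr, map_zero] at this
    simpa using congrArg TrivSqZeroExt.snd this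

variable (V : Set (σ → F)) (p : V)

theorem evalAt_mk (f : MvPolynomial σ F) :
    evalAt V p (Ideal.Quotient.mk _ f) = aeval (p : σ → F) f := rfl

/-- The maximal ideal at `p` is generated by the functions `x i - p i`. -/
theorem maximalIdeal_le_of_forall_mem {I : Ideal (LocalRingAt V p)}
    (h : ∀ i, algebraMap (CoordinateRing V) (LocalRingAt V p)
      (Ideal.Quotient.mk (vanishingIdeal F V) (X i - C ((p : σ → F) i))) ∈ I) :
    maximalIdeal (LocalRingAt V p) ≤ I := by
  refine maximalIdeal_localization_le _ fun a ha => ?_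
  obtain ⟨f, rfl⟩ := Ideal.Quotient.mk_surjective a
  rw [RingHom.mem_ker, evalAt_mk] at ha
  exact map_mem_of_aeval_eq_zero (L := LocalRingAt V p) (σ := σ) (I := I)
    ((algebraMap (CoordinateRing V) (LocalRingAt V p)).comp
      (Ideal.Quotient.mk (vanishingIdeal F V))) (p : σ → F) h ha

/-- If `V` contains the coordinate axes through the origin but satisfies some equation, then its
tangent space at the origin is the whole affine space, while its dimension is smaller; so the
origin is a singular point. -/
theorem not_isNonsingularPoint_zero [Infinite F] [Finite σ] [DecidableEq σ] (h0 : (0 : σ → F) ∈ V)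
    (haxes : ∀ i (t : F), Pi.single i t ∈ V) (hne : vanishingIdeal F V ≠ ⊥) :
    ¬ IsNonsingularPoint V ⟨0, h0⟩ := by
  let δ : CoordinateRing V →+* TrivSqZeroExt F (σ → F) :=
    Ideal.Quotient.lift _ (taylorOne F σ).toRingHom fun _ hf => taylorOne_eq_zero h0 haxes hf
  have hδ (a : CoordinateRing V) : (δ a).fst = evalAt V ⟨0, h0⟩ a := by
    obtain ⟨f, rfl⟩ := Ideal.Quotient.mk_surjective a
    exact fst_taylorOne f
  obtain ⟨D, hD, hmax⟩ := exists_localization_lift (RingHom.ker (evalAt V ⟨0, h0⟩)) δ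
    fun a => by rw [hδ, RingHom.mem_ker]
  have hcard := natCard_le_spanFinrank_maximalIdeal D hmax fun i =>
    ⟨algebraMap _ _ (Ideal.Quotient.mk _ (X i)),
      (algebraMap_mem_maximalIdeal_iff _ _).2 (by rw [RingHom.mem_ker, evalAt_mk]; simp), by
        rw [hD]
        change (taylorOne F σ (X i)).snd = _
        simp [taylorOne]⟩
  refine not_isRegularLocalRing_of_height_lt (RingHom.ker (evalAt V ⟨0, h0⟩)) ?_
  obtain ⟨f, hf, hf0⟩ := Submodule.exists_mem_ne_zero_of_ne_bot hne
  have hdim := ringKrullDim_succ_le_of_surjective (Ideal.Quotient.mk (vanishingIdeal F V))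
    Ideal.Quotient.mk_surjective (mem_nonZeroDivisors_of_ne_zero hf0)
    (Ideal.Quotient.eq_zero_iff_mem.2 hf)
  rw [MvPolynomial.ringKrullDim_of_isNoetherianRing, ringKrullDim_eq_zero_of_field,
    zero_add] at hdim
  have hh : ((RingHom.ker (evalAt V ⟨0, h0⟩)).height : WithBot ℕ∞) + 1 ≤ Nat.card σ :=
    le_trans (by gcongr; exact Ideal.height_le_ringKrullDim_of_isPrime) hdim
  have hh' : (RingHom.ker (evalAt V ⟨0, h0⟩)).height + 1 ≤ (Nat.card σ : ℕ∞) := by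
    exact_mod_cast hh
  have := (ENat.add_one_le_iff (by
    intro h
    rw [h, top_add] at hh'
    exact ENat.natCast_ne_top _ (top_le_iff.1 hh'))).1 hh'
  have h2 := this.trans_le (Nat.cast_le.2 hcard)
  exact_mod_cast h2

end Points

/-! ### Equations of the determinantal variety and of its jets -/

section Equations

variable {F : Type*} [Field F] {m n : ℕ}

theorem mem_detVariety_iff (x : Fin m × Fin n → F) :
    x ∈ detVariety F m n ↔ ∀ i k j l, x (i, j) * x (k, l) = x (i, l) * x (k, j) := by
  constructor
  · intro hx i k j l
    by_contra hne
    set M : Matrix (Fin m) (Fin n) F := Matrix.of fun i j => x (i, j)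
    have hdet : IsUnit (M.submatrix ![i, k] ![j, l]).det := by
      rw [isUnit_iff_ne_zero, Matrix.det_fin_two]
      simpa [M, sub_eq_zero] using hne
    have h2 := Matrix.rank_of_isUnit _ ((Matrix.isUnit_iff_isUnit_det _).2 hdet)
    have h3 : _ ≤ M.rank := Matrix.rank_submatrix_le M ![i, k] ![j, l]
    have h4 : M.rank ≤ 1 := hx
    rw [Fintype.card_fin] at h2
    omega
  · intro h
    by_cases h0 : ∃ i j, x (i, j) ≠ 0
    · obtain ⟨i, j, hij⟩ := h0
      have : (Matrix.of fun i j => x (i, j)) =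
          Matrix.vecMulVec (fun k => x (k, j) / x (i, j)) (fun l => x (i, l)) := by
        ext k l
        simp only [Matrix.of_apply, Matrix.vecMulVec_apply]
        field_simp
        linear_combination h i k j l
      change Matrix.rank _ ≤ 1
      rw [this]
      exact Matrix.rank_vecMulVec_le _ _
    · push Not at h0
      have : (Matrix.of fun i j => x (i, j)) = (0 : Matrix (Fin m) (Fin n) F) := by
        ext k l; simp [h0]
      change Matrix.rank _ ≤ 1
      rw [this, Matrix.rank_zero]
      exact zero_le_one

theorem fst_minor (i k : Fin m) (j l : Fin n) : (minor F m n i k j l).fst =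
    X (Sum.inl (i, j)) * X (Sum.inl (k, l)) - X (Sum.inl (i, l)) * X (Sum.inl (k, j)) := by
  rw [minor, Matrix.det_fin_two]
  simp [genericMatrix, TrivSqZeroExt.algebraMap_eq_inl]

theorem snd_minor (i k : Fin m) (j l : Fin n) : (minor F m n i k j l).snd =
    X (Sum.inl (i, j)) * X (Sum.inr (k, l)) + X (Sum.inr (i, j)) * X (Sum.inl (k, l)) -
      (X (Sum.inl (i, l)) * X (Sum.inr (k, j)) + X (Sum.inr (i, l)) * X (Sum.inl (k, j))) := by
  rw [minor, Matrix.det_fin_two]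
  simp [genericMatrix, TrivSqZeroExt.algebraMap_eq_inl]

theorem mem_jetVariety_iff (z : JetVar m n → F) :
    z ∈ jetVariety F m n ↔ ∀ i k j l,
      z (Sum.inl (i, j)) * z (Sum.inl (k, l)) = z (Sum.inl (i, l)) * z (Sum.inl (k, j)) ∧
      z (Sum.inl (i, j)) * z (Sum.inr (k, l)) + z (Sum.inr (i, j)) * z (Sum.inl (k, l)) =
        z (Sum.inl (i, l)) * z (Sum.inr (k, j)) + z (Sum.inr (i, l)) * z (Sum.inl (k, j)) := by
  have h : z ∈ jetVariety F m n ↔ ∀ i k j l, i < k → j < l →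
      aeval z (minor F m n i k j l).fst = 0 ∧ aeval z (minor F m n i k j l).snd = 0 := by
    rw [jetVariety, jetIdeal, zeroLocus_span]
    constructor
    · exact fun h i k j l hik hjl =>
        ⟨h _ ⟨i, k, j, l, hik, hjl, Or.inl rfl⟩, h _ ⟨i, k, j, l, hik, hjl, Or.inr rfl⟩⟩
    · rintro h f ⟨i, k, j, l, hik, hjl, rfl | rfl⟩
      exacts [(h i k j l hik hjl).1, (h i k j l hik hjl).2]
  simp only [fst_minor, snd_minor, map_sub, map_add, map_mul, aeval_X, sub_eq_zero] at h
  rw [h]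
  refine ⟨fun h i k j l => ?_, fun h i k j l _ _ => h i k j l⟩
  -- Exchanging the rows or the columns of a minor only changes its sign.
  rcases lt_trichotomy i k with hik | rfl | hik <;> rcases lt_trichotomy j l with hjl | rfl | hjl
  · exact h i k j l hik hjl
  · exact ⟨rfl, rfl⟩
  · obtain ⟨h1, h2⟩ := h i k l j hik hjl
    exact ⟨h1.symm, h2.symm⟩
  · exact ⟨by ring, by ring⟩
  · exact ⟨rfl, rfl⟩
  · exact ⟨by ring, by ring⟩
  · obtain ⟨h1, h2⟩ := h k i j l hik hjl
    exact ⟨by linear_combination -h1, by linear_combination -h2⟩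
  · exact ⟨rfl, rfl⟩
  · obtain ⟨h1, h2⟩ := h k i l j hik hjl
    exact ⟨by linear_combination h1, by linear_combination h2⟩

theorem base_mem_detVariety {z : JetVar m n → F} (hz : z ∈ jetVariety F m n) :
    (fun p => z (Sum.inl p)) ∈ detVariety F m n := by
  rw [mem_detVariety_iff]
  exact fun i k j l => ((mem_jetVariety_iff z).1 hz i k j l).1

end Equations

/-! ### Parametrizations -/

section Parametrizations

variable {m n : ℕ}

/-- The matrix `a bᵀ`, as a point of affine space. -/
def segrePoint {A : Type*} [CommRing A] (a : Fin m → A) (b : Fin n → A) : Fin m × Fin n → A :=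
  fun q => a q.1 * b q.2

/-- The first-order jet of `(a + t c) (b + t d)ᵀ`. -/
def segreJet {A : Type*} [CommRing A] (a c : Fin m → A) (b d : Fin n → A) : JetVar m n → A :=
  Sum.elim (segrePoint a b) (fun q => a q.1 * d q.2 + c q.1 * b q.2)

variable {F : Type*} [Field F]

theorem segrePoint_mem_detVariety (a : Fin m → F) (b : Fin n → F) :
    segrePoint a b ∈ detVariety F m n := by
  rw [mem_detVariety_iff]
  intro i k j l
  simp only [segrePoint]
  ring

theorem segreJet_mem_jetVariety (a c : Fin m → F) (b d : Fin n → F) :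
    segreJet a c b d ∈ jetVariety F m n := by
  rw [mem_jetVariety_iff]
  intro i k j l
  simp only [segreJet, segrePoint, Sum.elim_inl, Sum.elim_inr]
  constructor <;> ring

theorem exists_segreJet_of_base_ne_zero {z : JetVar m n → F} (hz : z ∈ jetVariety F m n)
    {p : Fin m} {q : Fin n} (hpq : z (Sum.inl (p, q)) ≠ 0) :
    ∃ a c b d, z = segreJet a c b d := by
  rw [mem_jetVariety_iff] at hz
  -- The normalization `a p = 1`, `c p = 0` leaves no choice.
  refine ⟨fun i => z (Sum.inl (i, q)) / z (Sum.inl (p, q)),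
    fun i => (z (Sum.inr (i, q)) - z (Sum.inl (i, q)) / z (Sum.inl (p, q)) * z (Sum.inr (p, q))) /
      z (Sum.inl (p, q)),
    fun j => z (Sum.inl (p, j)), fun j => z (Sum.inr (p, j)), ?_⟩
  ext (⟨i, j⟩ | ⟨i, j⟩)
  · simp only [segreJet, segrePoint, Sum.elim_inl]
    field_simp
    linear_combination (hz p i q j).1
  · simp only [segreJet, Sum.elim_inr]
    field_simp
    linear_combination z (Sum.inl (p, q)) * (hz p i q j).2 - z (Sum.inr (p, q)) * (hz p i q j).1

/-- The vector with entry `r` at `i₀` and the remaining entries given by `u`. -/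
def insertAt {A : Type*} (i₀ : Fin m) (r : A) (u : {i // i ≠ i₀} → A) : Fin m → A :=
  fun i => if h : i = i₀ then r else u ⟨i, h⟩

theorem insertAt_self {A : Type*} (i₀ : Fin m) (r : A) (u : {i // i ≠ i₀} → A) :
    insertAt i₀ r u i₀ = r := by simp [insertAt]

theorem insertAt_of_ne {A : Type*} (i₀ : Fin m) (r : A) (u : {i // i ≠ i₀} → A)
    (i : {i // i ≠ i₀}) : insertAt i₀ r u i = u i := by simp [insertAt, i.2]

theorem insertAt_restrict {A : Type*} (i₀ : Fin m) (a : Fin m → A) :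
    insertAt i₀ (a i₀) (fun i => a i) = a := by
  ext i
  by_cases h : i = i₀
  · subst h; simp [insertAt]
  · simp [insertAt, h]

theorem map_insertAt {A B : Type*} (f : A → B) (i₀ : Fin m) (r : A) (u : {i // i ≠ i₀} → A)
    (i : Fin m) : f (insertAt i₀ r u i) = insertAt i₀ (f r) (fun i => f (u i)) i := by
  unfold insertAt
  split_ifs <;> rfl

variable (n) in
/-- The coordinates on the set of matrices `a bᵀ` with `a i₀ = 1`: the other entries of `a`, and the
entries of `b`. -/
abbrev ChartVar (i₀ : Fin m) : Type := {i // i ≠ i₀} ⊕ Fin n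

theorem natCard_chartVar (i₀ : Fin m) : Nat.card (ChartVar n i₀) = m + n - 1 := by
  have : 0 < m := i₀.pos
  simp [Fintype.card_subtype_compl]
  omega

/-- The pullback of polynomials along `(a, b) ↦ a bᵀ` with `a i₀ = 1`. -/
def pointChart (F : Type*) [Field F] {m : ℕ} (n : ℕ) (i₀ : Fin m) :
    MvPolynomial (Fin m × Fin n) F →ₐ[F] MvPolynomial (ChartVar n i₀) F :=
  aeval (segrePoint (insertAt i₀ 1 fun i => X (Sum.inl i)) fun j => X (Sum.inr j))

/-- The pullback of polynomials along `(a, b, c, d) ↦ ` the jet of `(a + t c) (b + t d)ᵀ` with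
`a i₀ = 1` and `c i₀ = 0`; the second copy of the chart variables holds `c` and `d`. -/
def jetChart (F : Type*) [Field F] {m : ℕ} (n : ℕ) (i₀ : Fin m) :
    JetRing F m n →ₐ[F] MvPolynomial (ChartVar n i₀ ⊕ ChartVar n i₀) F :=
  aeval (segreJet (insertAt i₀ 1 fun i => X (Sum.inl (Sum.inl i)))
    (insertAt i₀ 0 fun i => X (Sum.inr (Sum.inl i)))
    (fun j => X (Sum.inl (Sum.inr j))) (fun j => X (Sum.inr (Sum.inr j))))

theorem aeval_pointChart (i₀ : Fin m) (w : ChartVar n i₀ → F) (f : MvPolynomial (Fin m × Fin n) F) :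
    aeval w (pointChart F n i₀ f) =
      aeval (segrePoint (insertAt i₀ 1 fun i => w (Sum.inl i)) fun j => w (Sum.inr j)) f := by
  have : (aeval w).comp (pointChart F n i₀) =
      aeval (segrePoint (insertAt i₀ 1 fun i => w (Sum.inl i)) fun j => w (Sum.inr j)) := by
    ext q
    simp [pointChart, segrePoint, map_insertAt (eval w)]
  exact DFunLike.congr_fun this f

theorem aeval_jetChart (i₀ : Fin m) (w : ChartVar n i₀ ⊕ ChartVar n i₀ → F) (f : JetRing F m n) :
    aeval w (jetChart F n i₀ f) =
      aeval (segreJet (insertAt i₀ 1 fun i => w (Sum.inl (Sum.inl i)))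
        (insertAt i₀ 0 fun i => w (Sum.inr (Sum.inl i)))
        (fun j => w (Sum.inl (Sum.inr j))) (fun j => w (Sum.inr (Sum.inr j)))) f := by
  have : (aeval w).comp (jetChart F n i₀) =
      aeval (segreJet (insertAt i₀ 1 fun i => w (Sum.inl (Sum.inl i)))
        (insertAt i₀ 0 fun i => w (Sum.inr (Sum.inl i)))
        (fun j => w (Sum.inl (Sum.inr j))) (fun j => w (Sum.inr (Sum.inr j)))) := by
    ext (q | q) <;>
    simp [jetChart, segreJet, segrePoint, map_insertAt (eval w)]
  exact DFunLike.congr_fun this f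

theorem pointChart_eq_zero [Infinite F] (i₀ : Fin m) {f : MvPolynomial (Fin m × Fin n) F}
    (hf : f ∈ vanishingIdeal F (detVariety F m n)) : pointChart F n i₀ f = 0 := by
  apply MvPolynomial.funext
  intro w
  rw [map_zero, ← aeval_eq_eval, aeval_pointChart]
  exact hf _ (segrePoint_mem_detVariety _ _)

/-- A polynomial that vanishes on all jets in the chart vanishes on all jets `(a + t c) (b + t d)ᵀ`:
those with `a i₀ ≠ 0` can be rescaled into the chart, and they are dense. -/
theorem aeval_segreJet_eq_zero [Infinite F] (i₀ : Fin m) {f : JetRing F m n}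
    (hf : jetChart F n i₀ f = 0) (a c : Fin m → F) (b d : Fin n → F) :
    aeval (segreJet a c b d) f = 0 := by
  have hne : ∀ (a c : Fin m → F) (b d : Fin n → F), a i₀ ≠ 0 → aeval (segreJet a c b d) f = 0 := by
    intro a c b d ha
    -- `(a + t c) (b + t d)ᵀ` does not change when the first factor is divided, and the second
    -- multiplied, by the dual number `a i₀ + t c i₀`.
    have h := congrArg (aeval (Sum.elim
      (Sum.elim (fun i : {i // i ≠ i₀} => a i / a i₀) (fun j => a i₀ * b j))
      (Sum.elim (fun i : {i // i ≠ i₀} => (c i - c i₀ / a i₀ * a i) / a i₀)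
        (fun j => a i₀ * d j + c i₀ * b j)))) hf
    rw [aeval_jetChart, map_zero] at h
    convert! h using 2
    have e1 : (insertAt i₀ 1 fun i : {i // i ≠ i₀} => a i / a i₀) = fun i => a i / a i₀ := by
      rw [← insertAt_restrict i₀ fun i => a i / a i₀, div_self ha]
    have e2 : (insertAt i₀ 0 fun i : {i // i ≠ i₀} => (c i - c i₀ / a i₀ * a i) / a i₀) =
        fun i => (c i - c i₀ / a i₀ * a i) / a i₀ := by
      rw [← insertAt_restrict i₀ fun i => (c i - c i₀ / a i₀ * a i) / a i₀]
      congr 1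
      field_simp
      ring
    simp only [Sum.elim_inl, Sum.elim_inr, e1, e2]
    congr 1
    ext (⟨i, j⟩ | ⟨i, j⟩)
    · simp only [segreJet, segrePoint, Sum.elim_inl]
      field_simp
    · simp only [segreJet, Sum.elim_inr]
      field_simp
      ring
  by_cases hc : a i₀ = 0
  · -- Restrict to the line through `a` in the direction of the `i₀`-th coordinate vector.
    let g : Polynomial F := aeval (segreJet (fun i => Polynomial.C (a i) +
      Polynomial.X * Polynomial.C (Pi.single i₀ 1 i)) (fun i => Polynomial.C (c i))
      (fun j => Polynomial.C (b j)) (fun j => Polynomial.C (d j))) f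
    have hg (t : F) : g.eval t = aeval (segreJet (a + t • Pi.single i₀ 1) c b d) f := by
      rw [← Polynomial.coe_aeval_eq_eval]
      change ((Polynomial.aeval t).comp (aeval _)) f = _
      congr 1
      ext (q | q) <;> simp [segreJet, segrePoint] <;> exact Or.inl (mul_comm _ _)
    have hg0 : g = 0 := by
      refine Polynomial.eq_zero_of_infinite_isRoot g
        ((Set.finite_singleton (0 : F)).infinite_compl.mono fun t ht => ?_)
      change g.eval t = 0
      rw [hg]
      refine hne _ _ _ _ ?_
      simpa [hc] using ht
    have := hg 0
    rw [hg0] at this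
    simpa using this.symm
  · exact hne a c b d hc

end Parametrizations

/-! ### Nonsingular points of the determinantal variety -/

section Nonsingular

variable {F : Type*} [Field F] {m n : ℕ}

theorem isUnit_algebraMap_localRingAt {σ : Type*} (V : Set (σ → F)) (p : V)
    {f : MvPolynomial σ F} (hf : aeval (p : σ → F) f ≠ 0) :
    IsUnit (algebraMap (CoordinateRing V) (LocalRingAt V p) (Ideal.Quotient.mk _ f)) :=
  IsLocalization.map_units (LocalRingAt V p)
    (⟨Ideal.Quotient.mk _ f, hf⟩ : (RingHom.ker (evalAt V p)).primeCompl)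

/-- On the open set where the entry at `(i₀, j₀)` does not vanish, the equations
`x i₀ j₀ * x i j = x i j₀ * x i₀ j` express all functions through the entries in column `j₀` and
row `i₀`. -/
theorem map_sub_mem_of_isUnit {L : Type*} [CommRing L] (e : MvPolynomial (Fin m × Fin n) F →+* L)
    (he : ∀ f ∈ vanishingIdeal F (detVariety F m n), e f = 0) {x : Fin m × Fin n → F}
    (hx : x ∈ detVariety F m n) {i₀ : Fin m} {j₀ : Fin n} (hunit : IsUnit (e (X (i₀, j₀))))
    {I : Ideal L} (hcol : ∀ i, e (X (i, j₀) - C (x (i, j₀))) ∈ I)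
    (hrow : ∀ j, e (X (i₀, j) - C (x (i₀, j))) ∈ I) (q : Fin m × Fin n) :
    e (X q - C (x q)) ∈ I := by
  obtain ⟨i, j⟩ := q
  rw [← Ideal.unit_mul_mem_iff_mem _ hunit]
  have h1 : e (X (i₀, j₀)) * e (X (i, j)) = e (X (i₀, j)) * e (X (i, j₀)) := by
    rw [← map_mul, ← map_mul, ← sub_eq_zero, ← map_sub]
    exact he _ fun y hy => by simp [(mem_detVariety_iff y).1 hy i₀ i j₀ j]
  have h2 : e (C (x (i₀, j₀))) * e (C (x (i, j))) = e (C (x (i₀, j))) * e (C (x (i, j₀))) := by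
    rw [← map_mul, ← map_mul, ← map_mul, ← map_mul]
    exact congrArg (fun c => e (C c)) ((mem_detVariety_iff _).1 hx i₀ i j₀ j)
  have h3 : e (X (i₀, j₀)) * e (X (i, j) - C (x (i, j))) =
      e (X (i₀, j)) * e (X (i, j₀) - C (x (i, j₀))) +
        e (C (x (i, j₀))) * e (X (i₀, j) - C (x (i₀, j))) -
        e (C (x (i, j))) * e (X (i₀, j₀) - C (x (i₀, j₀))) := by
    simp only [map_sub]
    linear_combination h1 - h2
  rw [h3]
  exact sub_mem (add_mem (Ideal.mul_mem_left _ _ (hcol i)) (Ideal.mul_mem_left _ _ (hrow j)))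
    (Ideal.mul_mem_left _ _ (hrow j₀))

theorem spanFinrank_maximalIdeal_detVariety_le (p : detVariety F m n) {i₀ : Fin m} {j₀ : Fin n}
    (hp : (p : Fin m × Fin n → F) (i₀, j₀) ≠ 0) :
    (maximalIdeal (LocalRingAt (detVariety F m n) p)).spanFinrank ≤ Nat.card (ChartVar n i₀) := by
  let e : MvPolynomial (Fin m × Fin n) F →+* LocalRingAt (detVariety F m n) p :=
    (algebraMap (CoordinateRing (detVariety F m n)) (LocalRingAt (detVariety F m n) p)).comp
      (Ideal.Quotient.mk (vanishingIdeal F (detVariety F m n)))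
  have he : ∀ f ∈ vanishingIdeal F (detVariety F m n), e f = 0 := fun f hf => by
    rw [RingHom.comp_apply, Ideal.Quotient.eq_zero_iff_mem.2 hf, map_zero]
  let u (q : Fin m × Fin n) : LocalRingAt (detVariety F m n) p :=
    e (X q - C ((p : Fin m × Fin n → F) q))
  let g : ChartVar n i₀ → LocalRingAt (detVariety F m n) p :=
    Sum.elim (fun i => u (i, j₀)) (fun j => u (i₀, j))
  have hrow (j) : u (i₀, j) ∈ Ideal.span (Set.range g) := Ideal.subset_span ⟨Sum.inr j, rfl⟩
  have hcol (i) : u (i, j₀) ∈ Ideal.span (Set.range g) := by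
    by_cases h : i = i₀
    · subst h; exact hrow j₀
    · exact Ideal.subset_span ⟨Sum.inl ⟨i, h⟩, rfl⟩
  have hunit : IsUnit (e (X (i₀, j₀))) := isUnit_algebraMap_localRingAt _ p (by simpa using hp)
  have hmax : maximalIdeal (LocalRingAt (detVariety F m n) p) = Ideal.span (Set.range g) := by
    have hu := map_sub_mem_of_isUnit (I := Ideal.span (Set.range g)) e he p.2 hunit hcol hrow
    refine le_antisymm (maximalIdeal_le_of_forall_mem _ p hu) (Ideal.span_le.2 ?_)
    have hmem (q) : u q ∈ maximalIdeal (LocalRingAt (detVariety F m n) p) := by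
      refine (algebraMap_mem_maximalIdeal_iff (RingHom.ker (evalAt (detVariety F m n) p)) _).2 ?_
      change aeval (p : Fin m × Fin n → F) (X q - C ((p : Fin m × Fin n → F) q)) = 0
      simp
    rintro _ ⟨i | j, rfl⟩
    exacts [hmem _, hmem _]
  rw [hmax]
  refine (Submodule.spanFinrank_span_le_ncard_of_finite (Set.finite_range g)).trans ?_
  rw [← Set.image_univ, ← Set.ncard_univ]
  exact Set.ncard_image_le Set.finite_univ

/-- The chart `(a, b) ↦ a bᵀ` with `a i₀ = 1` is an isomorphism after inverting the entry at
`(i₀, j₀)`; hence the local dimension is at least the number of its parameters. -/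
theorem natCard_chartVar_le_height [IsAlgClosed F] (p : detVariety F m n) {i₀ : Fin m} {j₀ : Fin n}
    (hp : (p : Fin m × Fin n → F) (i₀, j₀) ≠ 0) :
    (Nat.card (ChartVar n i₀) : ℕ∞) ≤ (RingHom.ker (evalAt (detVariety F m n) p)).height := by
  have : Infinite F := IsAlgClosed.instInfinite
  let f : CoordinateRing (detVariety F m n) →ₐ[F] MvPolynomial (ChartVar n i₀) F :=
    Ideal.Quotient.liftₐ _ (pointChart F n i₀) fun _ hf => pointChart_eq_zero i₀ hf
  have hf (g) : f (Ideal.Quotient.mk _ g) = pointChart F n i₀ g := rfl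
  let x : Fin m × Fin n → F := p
  let w : ChartVar n i₀ → F := Sum.elim (fun i => x (i, j₀) / x (i₀, j₀)) (fun j => x (i₀, j))
  have hw : segrePoint (insertAt i₀ 1 fun i => w (Sum.inl i)) (fun j => w (Sum.inr j)) = x := by
    have e1 : (insertAt i₀ 1 fun i : {i // i ≠ i₀} => x (i, j₀) / x (i₀, j₀)) =
        fun i => x (i, j₀) / x (i₀, j₀) := by
      rw [← insertAt_restrict i₀ fun i => x (i, j₀) / x (i₀, j₀), div_self hp]
    ext ⟨i, j⟩
    simp only [segrePoint, w, Sum.elim_inl, Sum.elim_inr, e1]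
    have := (mem_detVariety_iff x).1 p.2 i₀ i j₀ j
    have hp' : x (i₀, j₀) ≠ 0 := hp
    field_simp
    linear_combination -this
  rw [← height_vanishingIdeal_singleton w]
  refine height_le_height_comap f.toRingHom _ _ ?_ (Ideal.Quotient.mk _ (X (i₀, j₀))) ?_ ?_
  · ext a
    obtain ⟨g, rfl⟩ := Ideal.Quotient.mk_surjective a
    rw [RingHom.mem_ker, evalAt_mk, Ideal.mem_comap, mem_vanishingIdeal_singleton_iff]
    change _ ↔ aeval w (pointChart F n i₀ g) = 0
    rw [aeval_pointChart, hw]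
  · rw [RingHom.mem_ker, evalAt_mk, aeval_X]
    exact hp
  · refine exists_map_eq_pow_mul f _ ?_
    rintro (i | j)
    · refine ⟨1, Ideal.Quotient.mk _ (X (i, j₀)), ?_⟩
      simp [hf, pointChart, segrePoint, insertAt_self, insertAt_of_ne, mul_comm]
    · refine ⟨0, Ideal.Quotient.mk _ (X (i₀, j)), ?_⟩
      simp [hf, pointChart, segrePoint, insertAt_self]

theorem isNonsingularPoint_detVariety [IsAlgClosed F] (p : detVariety F m n)
    {q : Fin m × Fin n} (hp : (p : Fin m × Fin n → F) q ≠ 0) :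
    IsNonsingularPoint (detVariety F m n) p := by
  refine IsRegularLocalRing.of_spanFinrank_maximalIdeal_le (LocalRingAt (detVariety F m n) p) ?_
  rw [IsLocalization.AtPrime.ringKrullDim_eq_height (RingHom.ker (evalAt (detVariety F m n) p))]
  have h1 := spanFinrank_maximalIdeal_detVariety_le p (i₀ := q.1) (j₀ := q.2) hp
  have h2 := natCard_chartVar_le_height p (i₀ := q.1) (j₀ := q.2) hp
  have h3 := (Nat.cast_le (α := ℕ∞).2 h1).trans h2
  exact_mod_cast h3

theorem not_isNonsingularPoint_detVariety [Infinite F] (hm : 2 ≤ m) (hn : 2 ≤ n)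
    (h0 : (0 : Fin m × Fin n → F) ∈ detVariety F m n) :
    ¬ IsNonsingularPoint (detVariety F m n) ⟨0, h0⟩ := by
  refine not_isNonsingularPoint_zero _ h0 (fun q t => ?_) fun hbot => ?_
  · have : Pi.single q t = segrePoint (Pi.single q.1 t) (Pi.single q.2 (1 : F)) := by
      ext ⟨i, j⟩
      by_cases hi : i = q.1 <;> by_cases hj : j = q.2 <;>
        simp [segrePoint, Prod.ext_iff, hi, hj]
    rw [this]
    exact segrePoint_mem_detVariety _ _
  · let i (k : Fin 2) : Fin m := Fin.castLE hm k
    let j (k : Fin 2) : Fin n := Fin.castLE hn k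
    let f : MvPolynomial (Fin m × Fin n) F :=
      X (i 0, j 0) * X (i 1, j 1) - X (i 0, j 1) * X (i 1, j 0)
    have hf : f ∈ vanishingIdeal F (detVariety F m n) := fun y hy => by
      simp [f, (mem_detVariety_iff y).1 hy (i 0) (i 1) (j 0) (j 1)]
    rw [hbot, Ideal.mem_bot] at hf
    -- The minor does not vanish at the matrix with ones on the diagonal.
    have := congrArg (aeval fun q : Fin m × Fin n => if (q.1 : ℕ) = q.2 then (1 : F) else 0) hf
    simp [f, i, j] at this

end Nonsingular

/-! ### The ideal of the principal component -/

section Principal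

variable {F : Type*} [Field F] {m n : ℕ}

theorem principalIdeal_eq_vanishingIdeal :
    principalIdeal F m n = vanishingIdeal F (nonsingularJets F m n) :=
  le_antisymm (vanishingIdeal_anti_mono (zeroLocus_vanishingIdeal_le _))
    (le_vanishingIdeal_zeroLocus _)

variable [IsAlgClosed F]

theorem mem_nonsingularJets_of_base_ne_zero {z : JetVar m n → F} (hz : z ∈ jetVariety F m n)
    {q : Fin m × Fin n} (hq : z (Sum.inl q) ≠ 0) : z ∈ nonsingularJets F m n :=
  ⟨hz, base_mem_detVariety hz, isNonsingularPoint_detVariety ⟨_, base_mem_detVariety hz⟩ hq⟩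

/-- Every jet at a nonsingular point is the jet of a curve `(a + t c) (b + t d)ᵀ`. At the zero
matrix this uses that the latter is nonsingular only if there is just one row. -/
theorem exists_segreJet_of_mem_nonsingularJets (hm : 1 ≤ m) (hmn : m ≤ n) {z : JetVar m n → F}
    (hz : z ∈ nonsingularJets F m n) : ∃ a c b d, z = segreJet a c b d := by
  have : Infinite F := IsAlgClosed.instInfinite
  obtain ⟨hz, hV, hns⟩ := hz
  by_cases h : ∃ q, z (Sum.inl q) ≠ 0
  · obtain ⟨q, hq⟩ := h
    exact exists_segreJet_of_base_ne_zero hz hq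
  · push Not at h
    have h0 : (fun q => z (Sum.inl q)) = 0 := funext h
    obtain rfl | hm2 := hm.eq_or_lt
    · refine ⟨0, 1, fun j => z (Sum.inr (0, j)), 0, ?_⟩
      ext (⟨i, j⟩ | ⟨i, j⟩)
      · simp [segreJet, segrePoint, h]
      · simp [segreJet, Subsingleton.elim i 0]
    · revert hV
      rw [h0]
      exact fun hV hns =>
        absurd hns (not_isNonsingularPoint_detVariety hm2 (le_trans hm2 hmn) hV)

/-- The ideal of the principal component is the kernel of the pullback to the chart. -/
theorem principalIdeal_eq_ker (hm : 1 ≤ m) (hmn : m ≤ n) (i₀ : Fin m) (j₀ : Fin n) :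
    principalIdeal F m n = RingHom.ker (jetChart F n i₀) := by
  have : Infinite F := IsAlgClosed.instInfinite
  rw [principalIdeal_eq_vanishingIdeal]
  ext f
  rw [RingHom.mem_ker]
  constructor
  · intro hf
    -- On the chart, the base point is nonzero as soon as `b j₀` is.
    have h : jetChart F n i₀ f * X (Sum.inl (Sum.inr j₀)) = 0 := by
      apply MvPolynomial.funext
      intro w
      rw [map_zero, ← aeval_eq_eval, map_mul, aeval_X, aeval_jetChart]
      by_cases hw : w (Sum.inl (Sum.inr j₀)) = 0
      · rw [hw, mul_zero]
      · rw [hf _ (mem_nonsingularJets_of_base_ne_zero (q := (i₀, j₀))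
          (segreJet_mem_jetVariety _ _ _ _) ?_), zero_mul]
        simpa [segreJet, segrePoint, insertAt_self] using hw
    exact (mul_eq_zero.1 h).resolve_right (X_ne_zero _)
  · intro hf z hz
    obtain ⟨a, c, b, d, rfl⟩ := exists_segreJet_of_mem_nonsingularJets hm hmn hz
    exact aeval_segreJet_eq_zero i₀ hf a c b d

/-- The pullback embeds the quotient by its kernel in a polynomial ring, which bounds the dimension
from above. It becomes an isomorphism after inverting the `x`-coordinate at `(i₀, j₀)`, so a local
ring of the quotient surjects onto a local ring of the polynomial ring, which bounds it from
below. -/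
theorem ringKrullDim_quotient_ker_jetChart (i₀ : Fin m) (j₀ : Fin n) :
    ringKrullDim (JetRing F m n ⧸ RingHom.ker (jetChart F n i₀)) =
      Nat.card (ChartVar n i₀ ⊕ ChartVar n i₀) := by
  let f := Ideal.kerLiftAlg (jetChart F n i₀)
  have hf (g) : f (Ideal.Quotient.mk _ g) = jetChart F n i₀ g := rfl
  refine le_antisymm (ringKrullDim_le_natCard_of_injective f (Ideal.kerLiftAlg_injective _)) ?_
  let q := vanishingIdeal F {(1 : ChartVar n i₀ ⊕ ChartVar n i₀ → F)}
  have h : q.height ≤ (q.comap f.toRingHom).height := by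
    refine height_le_height_comap f.toRingHom q _ rfl
      (Ideal.Quotient.mk _ (X (Sum.inl (i₀, j₀)))) ?_ ?_
    · rw [Ideal.mem_comap, mem_vanishingIdeal_singleton_iff]
      change aeval _ (jetChart F n i₀ (X (Sum.inl (i₀, j₀)))) ≠ 0
      rw [aeval_jetChart]
      simp [segreJet, segrePoint, insertAt_self]
    · refine exists_map_eq_pow_mul f _ ?_
      rintro ((i | j) | (i | j))
      · refine ⟨1, Ideal.Quotient.mk _ (X (Sum.inl (i, j₀))), ?_⟩
        rw [hf, hf]
        simp [jetChart, segreJet, segrePoint, insertAt_self, insertAt_of_ne, mul_comm]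
      · refine ⟨0, Ideal.Quotient.mk _ (X (Sum.inl (i₀, j))), ?_⟩
        rw [hf, hf]
        simp [jetChart, segreJet, segrePoint, insertAt_self]
      · -- `c i` is eliminated from `y i j₀ = a i * d j₀ + c i * b j₀`.
        refine ⟨2, Ideal.Quotient.mk _ ((X (Sum.inl (i₀, j₀)) * X (Sum.inr (i.1, j₀)) -
          X (Sum.inl (i.1, j₀)) * X (Sum.inr (i₀, j₀)) : JetRing F m n)), ?_⟩
        rw [hf, hf]
        simp only [jetChart, segreJet, segrePoint, insertAt_self, insertAt_of_ne, map_sub, map_mul,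
          aeval_X, Sum.elim_inl, Sum.elim_inr]
        ring
      · refine ⟨0, Ideal.Quotient.mk _ (X (Sum.inr (i₀, j))), ?_⟩
        rw [hf, hf]
        simp [jetChart, segreJet, insertAt_self]
  rw [height_vanishingIdeal_singleton] at h
  have h' := Ideal.height_le_ringKrullDim_of_isPrime (I := q.comap f.toRingHom)
  refine le_trans ?_ h'
  exact_mod_cast h

end Principal

end DetJet

end

theorem mainTheorem4 (F : Type*) [Field F] [IsAlgClosed F] (m n : ℕ) (hm : 1 ≤ m) (hmn : m ≤ n) :
    ringKrullDim (DetJet.JetRing F m n ⧸ DetJet.principalIdeal F m n) =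
      ((2 * (m + n) - 2 : ℕ) : WithBot ℕ∞) := by
  have i₀ : Fin m := ⟨0, hm⟩
  have j₀ : Fin n := ⟨0, hm.trans hmn⟩
  rw [DetJet.principalIdeal_eq_ker hm hmn i₀ j₀, DetJet.ringKrullDim_quotient_ker_jetChart i₀ j₀,
    Nat.card_sum, DetJet.natCard_chartVar]
  congr 1
  omega
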